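/- Let $P$ be a Markov transition kernel on a measurable space $(\mathsf X,\mathcal B)$ with invariant probability measure $\pi$, and assume that the associated Markov chain is $\pi$-irreducible and Harris recurrent (that is, it has a maximal irreducibility measure $\psi$, and whenever $\psi(A)>0$, $A\in\mathcal B$, the chain started at any $x\in A$ visits $A$ infinitely often almost surely). Assume that there are $C\in\mathcal B$ with $\pi(C)>0$, a number $\varepsilon>0$ and a probability measure $\nu$ on $\mathcal B$ such that $$P(x,A)\ \ge\ \varepsilon\,\nu(A)\qquad\text{for all }x\in C,\ A\in\mathcal B .$$ For $x\in C$ let $R(x,\cdot)=(1-\varepsilon)^{-1}\bigl(P(x,\cdot)-\varepsilon\nu(\cdot)\bigr)$ (if $\varepsilon=1$, put $R(x,\cdot)=\nu$). The split chain $(X_n,\delta_n)_{n\ge0}$ is the Markov chain on $\mathsf X\times\{0,1\}$ which moves from $(x,\delta)$ as follows: the new first coordinate is drawn from $P(x,\cdot)$ if $x\notin C$, from $\nu$ if $x\in C$ and $\delta=1$, and from $R(x,\cdot)$ if $x\in C$ and $\delta=0$; the new second coordinate is drawn independently from the Bernoulli($\varepsilon$) distribution. Let $\alpha=C\times\{1\}$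 and $\tau_\alpha=\min\{n\ge1:(X_n,\delta_n)\in\alpha\}$, and let $\Pr_\alpha$ and $E_\alpha$ denote probability and expectation for the split chain with an arbitrary initial distribution concentrated on $\alpha$ (so that $X_1\sim\nu$). For $t\ge1$ put $$p_t=\frac{\Pr_\alpha(\tau_\alpha\ge t)}{E_\alpha(\tau_\alpha)},\qquad Q_t(A)=\Pr_\alpha(X_t\in A\mid\tau_\alpha\ge t)\quad(A\in\mathcal B),$$ with $Q_t:=0$ if $\Pr_\alpha(\tau_\alpha\ge t)=0$. Then $E_\alpha(\tau_\alpha)<\infty$, $\sum_{t\ge1}p_t=1$, $Q_t$ is a probability measure whenever $p_t\neq0$, and $$\pi(A)=\sum_{t=1}^\infty Q_t(A)\,p_t\qquad\text{for all }A\in\mathcal B .$$ -/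

import Mathlib

open MeasureTheory ProbabilityTheory Filter
open scoped ENNReal NNReal

noncomputable section

namespace SplitChain

variable {X : Type*} [MeasurableSpace X]

/-! ### Markov chains on a general state space -/

/-- The law, on the space of trajectories `ℕ → S`, of the time-homogeneous Markov chain with
transition kernel `P` and initial distribution `μ₀`. -/
def chainLaw {S : Type*} [MeasurableSpace S] (P : Kernel S S) [IsMarkovKernel P]
    (μ₀ : Measure S) : Measure (ℕ → S) :=
  Kernel.trajMeasure (X := fun _ => S) μ₀
    (fun n => P.comap (fun h : (Finset.Iic n → S) => h ⟨n, Finset.mem_Iic.2 le_rfl⟩)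
      (measurable_pi_apply _))

instance {S : Type*} [MeasurableSpace S] (P : Kernel S S) [IsMarkovKernel P]
    (μ₀ : Measure S) [IsProbabilityMeasure μ₀] : IsProbabilityMeasure (chainLaw P μ₀) := by
  unfold chainLaw
  infer_instance

/-- `ψ` is a maximal irreducibility measure of `P`: the chain is `ψ`-irreducible, and every
measure `φ` for which the chain is `φ`-irreducible is absolutely continuous with respect to `ψ`. -/
def IsMaximalIrreducibilityMeasure (P : Kernel X X) (ψ : Measure X) : Prop :=
  Kernel.IsIrreducible ψ P ∧ ∀ φ : Measure X, Kernel.IsIrreducible φ P → φ ≪ ψ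

/-- Harris recurrence: the chain has a maximal irreducibility measure `ψ`, and whenever
`ψ A > 0`, the chain started at any point of `A` almost surely visits `A` infinitely often. -/
def IsHarrisRecurrent (P : Kernel X X) [IsMarkovKernel P] : Prop :=
  ∃ ψ : Measure X, IsMaximalIrreducibilityMeasure P ψ ∧
    ∀ A : Set X, MeasurableSet A → 0 < ψ A → ∀ x ∈ A,
      ∀ᵐ ω ∂(chainLaw P (Measure.dirac x)), ∃ᶠ n in atTop, ω n ∈ A

/-! ### The minorization condition and the split chain -/

/-- The one-step minorization condition `P(x, ·) ≥ ε ν(·)` for all `x ∈ C`, where `C` is a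
measurable set of positive `π`-measure and `ε > 0`. -/
structure OneStepMinorization (P : Kernel X X) (π : Measure X) (C : Set X) (ε : ℝ≥0)
    (ν : Measure X) : Prop where
  measurableSet : MeasurableSet C
  measure_pos : 0 < π C
  eps_pos : 0 < ε
  minorization : ∀ x ∈ C, ε • ν ≤ P x

variable {P : Kernel X X} {π : Measure X} {C : Set X} {ε : ℝ≥0} {ν : Measure X}

lemma OneStepMinorization.eps_le_one [IsMarkovKernel P] [IsProbabilityMeasure ν]
    (h : OneStepMinorization P π C ε ν) : ε ≤ 1 := by
  obtain ⟨x, hx⟩ := nonempty_of_measure_ne_zero h.measure_pos.ne'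
  have := h.minorization x hx Set.univ
  simp only [Measure.smul_apply, measure_univ] at this
  simpa [ENNReal.smul_def] using this

open scoped Classical in
/-- The residual measure `R(x, ·) = (1 - ε)⁻¹ (P(x, ·) - ε ν(·))` for `x ∈ C`, and
`R(x, ·) = 0` for `x ∉ C`. If `ε = 1` the formula reads `0 / 0` and we put `R(x, ·) = ν` for
`x ∈ C`. -/
def residual (P : Kernel X X) (C : Set X) (ε : ℝ≥0) (ν : Measure X) (x : X) : Measure X :=
  if x ∈ C then (if ε = 1 then ν else (1 - ε)⁻¹ • (P x - ε • ν)) else 0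

open scoped Classical in
/-- The law of `X_{n+1}` given `(X_n, δ_n) = (x, δ)` in the split chain: `P(x, ·)` if `x ∉ C`;
`ν` if `x ∈ C` and `δ = 1`; `R(x, ·)` if `x ∈ C` and `δ = 0`. -/
def stepMeasure (P : Kernel X X) (C : Set X) (ε : ℝ≥0) (ν : Measure X) (z : X × Bool) :
    Measure X :=
  if z.1 ∈ C then (if z.2 = true then ν else residual P C ε ν z.1) else P z.1

lemma OneStepMinorization.measurable_residual [IsMarkovKernel P] [IsProbabilityMeasure ν]
    (h : OneStepMinorization P π C ε ν) : Measurable (residual P C ε ν) := by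
  classical
  refine Measure.measurable_of_measurable_coe _ fun A hA => ?_
  by_cases h1 : ε = 1
  · have : (fun x => residual P C ε ν x A) = fun x => if x ∈ C then ν A else 0 := by
      ext x
      by_cases hx : x ∈ C <;> simp [residual, hx, h1]
    rw [this]
    exact Measurable.ite h.measurableSet measurable_const measurable_const
  · have : (fun x => residual P C ε ν x A) =
        fun x => if x ∈ C then ((1 - ε)⁻¹ : ℝ≥0) • (P x A - ε • ν A) else 0 := by
      ext x
      by_cases hx : x ∈ C
      · simp only [residual, hx, h1, if_true, if_false, Measure.smul_apply]
        rw [Measure.sub_apply hA (h.minorization x hx), Measure.smul_apply]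
      · simp [residual, hx]
    rw [this]
    refine Measurable.ite h.measurableSet ?_ measurable_const
    exact ((Kernel.measurable_coe P hA).sub measurable_const).const_smul _

lemma OneStepMinorization.measurable_stepMeasure [IsMarkovKernel P] [IsProbabilityMeasure ν]
    (h : OneStepMinorization P π C ε ν) : Measurable (stepMeasure P C ε ν) := by
  classical
  refine Measurable.ite (measurable_fst h.measurableSet)
    (Measurable.ite (measurable_snd (measurableSet_singleton true)) measurable_const ?_) ?_
  · exact h.measurable_residual.comp measurable_fst
  · exact P.measurable.comp measurable_fst

/-- The kernel `(x, δ) ↦ stepMeasure P C ε ν (x, δ)`. -/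
def stepKernel [IsMarkovKernel P] [IsProbabilityMeasure ν]
    (h : OneStepMinorization P π C ε ν) : Kernel (X × Bool) X where
  toFun := stepMeasure P C ε ν
  measurable' := h.measurable_stepMeasure

instance [IsMarkovKernel P] [IsProbabilityMeasure ν]
    (h : OneStepMinorization P π C ε ν) : IsMarkovKernel (stepKernel h) := by
  refine ⟨fun z => ?_⟩
  change IsProbabilityMeasure (stepMeasure P C ε ν z)
  unfold stepMeasure
  split_ifs with hz hd
  · infer_instance
  · unfold residual
    rw [if_pos hz]
    split_ifs with h1
    · infer_instance
    · refine ⟨?_⟩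
      have hlt : ε < 1 := lt_of_le_of_ne h.eps_le_one h1
      have hne : (1 - ε : ℝ≥0) ≠ 0 := (tsub_pos_of_lt hlt).ne'
      rw [Measure.smul_apply, Measure.sub_apply MeasurableSet.univ (h.minorization _ hz),
        Measure.smul_apply, measure_univ, measure_univ]
      have e : (1 : ℝ≥0∞) - ε • (1 : ℝ≥0∞) = ((1 - ε : ℝ≥0) : ℝ≥0∞) := by
        simp [ENNReal.smul_def]
      rw [e, ENNReal.smul_def, smul_eq_mul, ← ENNReal.coe_mul, inv_mul_cancel₀ hne,
        ENNReal.coe_one]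
  · infer_instance

/-- The Bernoulli distribution `Ber(ε)` on `{0, 1}`, with `1` encoded as `true`. -/
def coin (ε : ℝ≥0) : Measure Bool :=
  ε • Measure.dirac true + (1 - ε) • Measure.dirac false

lemma OneStepMinorization.isProbabilityMeasure_coin [IsMarkovKernel P] [IsProbabilityMeasure ν]
    (h : OneStepMinorization P π C ε ν) : IsProbabilityMeasure (coin ε) := by
  refine ⟨?_⟩
  simp only [coin, Measure.add_apply, Measure.smul_apply, measure_univ, ENNReal.smul_def,
    smul_eq_mul, mul_one]
  rw [← ENNReal.coe_add, add_tsub_cancel_of_le h.eps_le_one, ENNReal.coe_one]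

/-- The transition kernel `P'` of the split chain on `X × {0, 1}`:
`P'[(x, δ), A × {δ'}] = stepMeasure (x, δ) A * Ber(ε){δ'}`. -/
def splitKernel [IsMarkovKernel P] [IsProbabilityMeasure ν]
    (h : OneStepMinorization P π C ε ν) : Kernel (X × Bool) (X × Bool) :=
  (stepKernel h) ×ₖ (Kernel.const (X × Bool) (coin ε))

instance [IsMarkovKernel P] [IsProbabilityMeasure ν]
    (h : OneStepMinorization P π C ε ν) : IsMarkovKernel (splitKernel h) := by
  have := h.isProbabilityMeasure_coin
  unfold splitKernel
  infer_instance

/-- The atom `α = C × {1}`. -/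
def atom (C : Set X) : Set (X × Bool) := C ×ˢ {true}

/-- The first return time `τ_α = min {n ≥ 1 : (X_n, δ_n) ∈ α}` (`⊤` if there is no such `n`),
as a function of the trajectory of the split chain. -/
def returnTime (C : Set X) (ω : ℕ → X × Bool) : ℕ∞ :=
  hittingAfter (fun n (ω : ℕ → X × Bool) => ω n) (atom C) 1 ω

/-- `E(τ_α)` under the law `Pr` of the split chain. -/
def expectedReturnTime (Pr : Measure (ℕ → X × Bool)) (C : Set X) : ℝ≥0∞ :=
  ∫⁻ ω, (returnTime C ω : ℝ≥0∞) ∂Pr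

/-- `p_t = Pr(τ_α ≥ t) / E(τ_α)` under the law `Pr` of the split chain. -/
def mixWeight (Pr : Measure (ℕ → X × Bool)) (C : Set X) (t : ℕ) : ℝ≥0∞ :=
  Pr {ω | (t : ℕ∞) ≤ returnTime C ω} / expectedReturnTime Pr C

/-- `Q_t(·) = Pr(X_t ∈ · | τ_α ≥ t)` under the law `Pr` of the split chain. (This is the zero
measure when the conditioning event is null, in which case `p_t = 0`.) -/
def mixComponent (Pr : Measure (ℕ → X × Bool)) (C : Set X) (t : ℕ) : Measure X :=
  (ProbabilityTheory.cond Pr {ω | (t : ℕ∞) ≤ returnTime C ω}).map (fun ω => (ω t).1)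

end SplitChain

end

/-!
The split chain has the atom `α = C × {1}`: from every point of `α` it moves by the same law
`ν ⊗ Ber(ε)`. Averaging its transition over the coin gives back `P` (`stepMeasure_average`), so
`π' = π ⊗ Ber(ε)` is invariant for it, and `π'(α) = ε π(C) > 0`.

Let `e_t` be the law of `Z_t` on the event `τ_α ≥ t`, where `Z` is the split chain started in `α`.
By the Markov property `e_1 = ν ⊗ Ber(ε)`, and `e_{t+1}` arises from `e_t` by dropping the mass in
`α` and applying the kernel once (`map_restrict_chainLaw`). The occupation measure `m = ∑ e_t` has
total mass `∑ Pr_α(τ_α ≥ t) = E_α(τ_α)`, and its marginal on `X` is `E_α(τ_α) ∑ p_t Q_t`. Hence the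
theorem says that `π' = π'(α) m`.

* Decomposing `π'` according to the last visit to `α` gives `π'(α) m ≤ π'` (`smul_occupation_le`).
  In particular `E_α(τ_α) ≤ 1 / π'(α) < ∞`.
* As `m` is finite, the return to `α` is almost sure, which reads `m(α) = 1` (`occupation_atom`).
  Therefore `m` is invariant (`invariant_occupation`).
* So `π' - π'(α) m` is a finite invariant measure which does not charge `α`. Such a measure has the
  form `r ⊗ Ber(ε)` with `r` invariant for `P` and `r(C) = 0`, and `r = 0` since `P` is
  `π`-irreducible and `π(C) > 0` (`eq_zero_of_invariant_splitKernel`).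
-/

namespace SplitChain

/-! ### Kac's formula for a kernel with an atom -/

section Excursion

variable {S : Type*} [MeasurableSpace S]

/-- The law of the first step of a `κ`-chain started from the part of `μ` that lies outside `a`. -/
noncomputable def tabooStep (κ : Kernel S S) (a : Set S) (μ : Measure S) : Measure S :=
  (μ.restrict aᶜ).bind κ

/-- The sub-probability laws `Pr(Z_{t+1} ∈ ·, τ_a ≥ t + 1)` of an excursion which leaves `a` with
law `η` and then moves by `κ` until it returns to `a`. The index is shifted by one, so that
`excursionLaw κ a η 0 = η` is the law at time `1`. -/
noncomputable def excursionLaw (κ : Kernel S S) (a : Set S) (η : Measure S) : ℕ → Measure S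
  | 0 => η
  | t + 1 => tabooStep κ a (excursionLaw κ a η t)

/-- The occupation measure of one excursion, the sum of `excursionLaw κ a η t` over all `t`. -/
noncomputable def occupation (κ : Kernel S S) (a : Set S) (η : Measure S) : Measure S :=
  Measure.sum (excursionLaw κ a η)

variable {κ : Kernel S S} {a : Set S} {η μ μ' : Measure S}

lemma tabooStep_apply {B : Set S} (hB : MeasurableSet B) :
    tabooStep κ a μ B = ∫⁻ z in aᶜ, κ z B ∂μ := by
  rw [tabooStep, Measure.bind_apply hB κ.aemeasurable]

lemma tabooStep_univ [IsMarkovKernel κ] : tabooStep κ a μ Set.univ = μ aᶜ := by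
  rw [tabooStep_apply MeasurableSet.univ]
  simp

lemma tabooStep_mono (h : μ ≤ μ') : tabooStep κ a μ ≤ tabooStep κ a μ' := by
  refine Measure.le_intro fun B hB _ => ?_
  rw [tabooStep_apply hB, tabooStep_apply hB]
  exact lintegral_mono' (Measure.restrict_mono le_rfl h) le_rfl

lemma tabooStep_smul (c : ℝ≥0∞) : tabooStep κ a (c • μ) = c • tabooStep κ a μ := by
  rw [tabooStep, tabooStep, Measure.restrict_smul, Measure.bind_smul]

lemma tabooStep_add : tabooStep κ a (μ + μ') = tabooStep κ a μ + tabooStep κ a μ' := by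
  ext B hB
  rw [Measure.add_apply, tabooStep_apply hB, tabooStep_apply hB, tabooStep_apply hB,
    Measure.restrict_add, lintegral_add_measure]

lemma tabooStep_sum (m : ℕ → Measure S) :
    tabooStep κ a (Measure.sum m) = Measure.sum fun t => tabooStep κ a (m t) := by
  ext B hB
  simp_rw [Measure.sum_apply _ hB, tabooStep_apply hB]
  rw [Measure.restrict_sum_of_countable, lintegral_sum_measure]

/-- Split according to whether the present state lies in `a`, from where the chain jumps to `η`. -/
lemma bind_eq_smul_add_tabooStep (ha : MeasurableSet a) (hκ : ∀ z ∈ a, κ z = η) (μ : Measure S) :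
    μ.bind κ = μ a • η + tabooStep κ a μ := by
  ext B hB
  rw [Measure.bind_apply hB κ.aemeasurable, Measure.add_apply, tabooStep_apply hB,
    ← lintegral_add_compl _ ha, Measure.smul_apply, smul_eq_mul,
    setLIntegral_congr_fun (g := fun _ => η B) ha (fun z hz => by simp only [hκ z hz]),
    setLIntegral_const, mul_comm]

lemma sum_range_succ_excursionLaw (n : ℕ) :
    ∑ t ∈ Finset.range (n + 1), excursionLaw κ a η t
      = η + tabooStep κ a (∑ t ∈ Finset.range n, excursionLaw κ a η t) := by
  induction n with
  | zero => simp [excursionLaw, tabooStep]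
  | succ n ih =>
    rw [Finset.sum_range_succ, ih, add_assoc]
    rw [show excursionLaw κ a η (n + 1) = tabooStep κ a (excursionLaw κ a η n) from rfl,
      ← tabooStep_add, ← Finset.sum_range_succ, ih]

lemma occupation_eq : occupation κ a η = η + tabooStep κ a (occupation κ a η) := by
  ext B hB
  rw [occupation, tabooStep_sum, Measure.add_apply, Measure.sum_apply _ hB, Measure.sum_apply _ hB,
    tsum_eq_zero_add' ENNReal.summable]
  rfl

/-- Half of Kac's formula: an invariant measure dominates the occupation measure of an excursion,
weighted by the mass of the atom. -/
lemma smul_occupation_le (ha : MeasurableSet a) (hκ : ∀ z ∈ a, κ z = η) (hμ : κ.Invariant μ) :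
    μ a • occupation κ a η ≤ μ := by
  have key : ∀ n, μ a • ∑ t ∈ Finset.range n, excursionLaw κ a η t ≤ μ := by
    intro n
    induction n with
    | zero => simp [Measure.zero_le]
    | succ n ih =>
      rw [sum_range_succ_excursionLaw, smul_add, ← tabooStep_smul]
      conv_rhs => rw [← hμ.def, bind_eq_smul_add_tabooStep ha hκ]
      gcongr
      exact tabooStep_mono ih
  refine Measure.le_intro fun B hB _ => ?_
  rw [Measure.smul_apply, occupation, Measure.sum_apply _ hB, smul_eq_mul, ← ENNReal.tsum_mul_left]
  refine ENNReal.tsum_le_of_sum_range_le fun n => ?_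
  have := key n B
  simpa [Measure.smul_apply, Measure.finsetSum_apply, Finset.mul_sum] using this

lemma occupation_univ_lt_top [IsFiniteMeasure μ] (ha : MeasurableSet a)
    (hκ : ∀ z ∈ a, κ z = η) (hμ : κ.Invariant μ) (hpos : μ a ≠ 0) :
    occupation κ a η Set.univ < ∞ := by
  have h := smul_occupation_le ha hκ hμ Set.univ
  rw [Measure.smul_apply, smul_eq_mul] at h
  exact (ENNReal.lt_top_of_mul_ne_top_right (h.trans_lt (measure_lt_top μ _)).ne hpos)

/-- An excursion with finite expected length returns to the atom exactly once: mass is created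
only at the start and destroyed only in `a`. -/
lemma occupation_atom [IsMarkovKernel κ] [IsProbabilityMeasure η] (ha : MeasurableSet a)
    (hfin : occupation κ a η Set.univ < ∞) : occupation κ a η a = 1 := by
  have h := congrArg (fun m => m Set.univ) (occupation_eq (κ := κ) (a := a) (η := η))
  simp only [Measure.add_apply, measure_univ, tabooStep_univ] at h
  rw [← measure_add_measure_compl ha] at h hfin
  exact (ENNReal.add_left_inj (ENNReal.add_lt_top.1 hfin).2.ne).1 h

lemma invariant_occupation [IsMarkovKernel κ] [IsProbabilityMeasure η] (ha : MeasurableSet a)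
    (hκ : ∀ z ∈ a, κ z = η) (hfin : occupation κ a η Set.univ < ∞) :
    κ.Invariant (occupation κ a η) := by
  rw [Kernel.Invariant, bind_eq_smul_add_tabooStep ha hκ, occupation_atom ha hfin, one_smul,
    ← occupation_eq]

/-- Kac's formula: if no nonzero finite invariant measure gives mass zero to the atom `a`, then an
invariant measure is the multiple `μ a` of the occupation measure, because the difference of the
two is invariant and does not charge `a`. -/
lemma eq_smul_occupation [IsMarkovKernel κ] [IsProbabilityMeasure η] [IsFiniteMeasure μ]
    (ha : MeasurableSet a) (hκ : ∀ z ∈ a, κ z = η) (hμ : κ.Invariant μ) (hpos : μ a ≠ 0)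
    (huniq : ∀ ρ : Measure S, IsFiniteMeasure ρ → κ.Invariant ρ → ρ a = 0 → ρ = 0) :
    μ = μ a • occupation κ a η := by
  have hfin := occupation_univ_lt_top ha hκ hμ hpos
  have hle := smul_occupation_le ha hκ hμ
  have hinv := invariant_occupation ha hκ hfin
  have hocc := occupation_atom ha hfin
  generalize occupation κ a η = m at hfin hle hinv hocc
  have : IsFiniteMeasure (μ a • m) := isFiniteMeasure_of_le μ hle
  have hsum : μ - μ a • m + μ a • m = μ := Measure.sub_add_cancel_of_le hle
  have hzero : μ - μ a • m = 0 := by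
    refine huniq _ inferInstance ?_ ?_
    · have h : (μ a • m).bind κ + (μ - μ a • m).bind κ = μ a • m + (μ - μ a • m) := by
        rw [add_comm, ← Measure.comp_add, add_comm (μ a • m), hsum, hμ.def]
      rwa [Measure.bind_smul, hinv.def, Measure.add_right_inj] at h
    · rw [Measure.sub_apply ha hle, Measure.smul_apply, hocc, smul_eq_mul, mul_one, tsub_self]
  rw [hzero, zero_add] at hsum
  exact hsum.symm

end Excursion

/-! ### Excursions of the trajectories -/

section Trajectory

variable {S : Type*} [MeasurableSpace S] {κ : Kernel S S} [IsMarkovKernel κ]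
  {a : Set S} {η μ₀ : Measure S}

lemma map_zero_chainLaw [IsProbabilityMeasure μ₀] :
    (chainLaw κ μ₀).map (fun ω => ω 0) = μ₀ := by
  have hcomp : (fun ω : ℕ → S => ω 0)
      = MeasurableEquiv.piUnique (fun _ : Finset.Iic 0 => S) ∘ Preorder.frestrictLe 0 := rfl
  rw [hcomp, ← Measure.map_map (by fun_prop) (by fun_prop), chainLaw, Kernel.trajMeasure,
    Measure.map_comp _ _ (by fun_prop), Kernel.traj_map_frestrictLe, Kernel.partialTraj_self,
    Measure.id_comp, MeasurableEquiv.map_map_symm]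

/-- The Markov property: on an event `G` that is determined by the coordinates up to time `n`,
the law of `ω (n + 1)` arises from that of `ω n` by one step of the kernel. -/
lemma map_succ_restrict_chainLaw [IsProbabilityMeasure μ₀] (n : ℕ)
    {G : Set (Finset.Iic n → S)} (hG : MeasurableSet G) :
    ((chainLaw κ μ₀).restrict (Preorder.frestrictLe n ⁻¹' G)).map (fun ω => ω (n + 1))
      = (((chainLaw κ μ₀).restrict (Preorder.frestrictLe n ⁻¹' G)).map (fun ω => ω n)).bind κ := by
  have hmeas := Preorder.measurable_frestrictLe (X := fun _ => S) n
  ext B hB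
  have h := congrArg (fun m => m (G ×ˢ B))
    (Kernel.map_frestrictLe_trajMeasure_compProd_eq_map_trajMeasure (X := fun _ => S) (μ₀ := μ₀)
      (κ := fun n => κ.comap (fun h : (Finset.Iic n → S) => h ⟨n, Finset.mem_Iic.2 le_rfl⟩)
        (measurable_pi_apply _)) (a := n))
  change ((chainLaw κ μ₀).map _ ⊗ₘ _) _ = (chainLaw κ μ₀).map _ _ at h
  rw [Measure.compProd_apply_prod hG hB, Measure.map_apply (by fun_prop) (hG.prod hB),
    setLIntegral_map hG (Kernel.measurable_coe _ hB) hmeas] at h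
  rw [Measure.map_apply (by fun_prop) hB, Measure.bind_apply hB κ.aemeasurable,
    lintegral_map (Kernel.measurable_coe _ hB) (by fun_prop),
    Measure.restrict_apply ((measurable_pi_apply (n + 1)) hB)]
  rw [Set.inter_comm]
  exact h.symm

/-- If `κ` has law `η` at every point of `a` and the chain starts in `a`, then `excursionLaw κ a η t`
is the law of `ω (t + 1)` on the event that `a` is not visited at the times `1, …, t`. -/
lemma map_restrict_chainLaw [IsProbabilityMeasure μ₀] (ha : MeasurableSet a)
    (hκ : ∀ z ∈ a, κ z = η) (hμ₀ : μ₀ aᶜ = 0) (t : ℕ) :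
    ((chainLaw κ μ₀).restrict {ω | ∀ j ∈ Set.Ico 1 (t + 1), ω j ∉ a}).map (fun ω => ω (t + 1))
      = excursionLaw κ a η t := by
  induction t with
  | zero =>
    have h := map_succ_restrict_chainLaw (κ := κ) (μ₀ := μ₀) 0 MeasurableSet.univ
    have hμ₀a : μ₀ a = 1 := by rw [prob_compl_eq_zero_iff ha] at hμ₀; exact hμ₀
    have : tabooStep κ a μ₀ = 0 := by
      rw [← Measure.measure_univ_eq_zero, tabooStep_univ, hμ₀]
    simpa [map_zero_chainLaw, bind_eq_smul_add_tabooStep ha hκ, hμ₀a, this, excursionLaw] using h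
  | succ t ih =>
    let G : Set (Finset.Iic (t + 1) → S) :=
      {x | ∀ j, ∀ hj : j ∈ Set.Ico 1 (t + 1 + 1),
        x ⟨j, Finset.mem_Iic.2 (Nat.lt_succ_iff.1 hj.2)⟩ ∉ a}
    have hG : MeasurableSet G := by
      simp only [G, Set.ofPred_forall]
      exact MeasurableSet.iInter fun j => MeasurableSet.iInter fun hj =>
        ha.compl.preimage (measurable_pi_apply _)
    have h := map_succ_restrict_chainLaw (κ := κ) (μ₀ := μ₀) (t + 1) hG
    have hpre : (Preorder.frestrictLe (π := fun _ => S) (t + 1)) ⁻¹' G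
        = {ω | ∀ j ∈ Set.Ico 1 (t + 1 + 1), ω j ∉ a} := rfl
    rw [hpre] at h
    rw [h, excursionLaw, tabooStep, ← ih, Measure.restrict_map (by fun_prop) ha.compl,
      Measure.restrict_restrict ((measurable_pi_apply (t + 1)) ha.compl)]
    congr 3
    ext ω
    simp only [Set.mem_ofPred_eq, Set.mem_inter_iff, Set.mem_preimage, Set.mem_compl_iff,
      Set.mem_Ico]
    constructor
    · exact fun h => ⟨h _ (by omega), fun j hj => h j (by omega)⟩
    · rintro ⟨h1, h2⟩ j hj
      obtain rfl | hlt := eq_or_lt_of_le (Nat.lt_succ_iff.1 hj.2)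
      · exact h1
      · exact h2 j ⟨hj.1, hlt⟩

end Trajectory

/-- An extended natural number counts the positive integers that are at most it. With
this the expected return time is the sum of the tail probabilities. -/
lemma tsum_ite_succ_le (n : ℕ∞) :
    ∑' t : ℕ, (if ((t + 1 : ℕ) : ℕ∞) ≤ n then (1 : ℝ≥0∞) else 0) = n := by
  induction n using ENat.recTopCoe with
  | top => simp
  | coe n =>
    rw [tsum_eq_sum (s := Finset.range n) (fun t ht => ?_)]
    · rw [Finset.sum_congr rfl (g := fun _ => 1) fun t ht => ?_]
      · simp
      · rw [if_pos]
        exact_mod_cast Finset.mem_range.1 ht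
    · rw [if_neg]
      rw [Nat.cast_le]
      simpa using ht

/-! ### The return time and the split kernel -/

lemma setOf_le_returnTime {X : Type*} {C : Set X} (t : ℕ) :
    {ω : ℕ → X × Bool | (t : ℕ∞) ≤ returnTime C ω}
      = {ω | ∀ j ∈ Set.Ico 1 t, ω j ∉ atom C} := by
  ext ω
  have h := hittingAfter_lt_iff (u := fun n (ω : ℕ → X × Bool) => ω n) (s := atom C) (n := 1)
    (i := t) (ω := ω)
  rw [Set.mem_ofPred_eq, ← not_lt]
  refine (not_congr h).trans ?_
  simp

section Split

variable {X : Type*} [MeasurableSpace X] {P : Kernel X X} [IsMarkovKernel P] {π : Measure X}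
  {C : Set X} {ε : ℝ≥0} {ν : Measure X} [IsProbabilityMeasure ν]

lemma measurableSet_atom (hC : MeasurableSet C) : MeasurableSet (atom C) :=
  hC.prod (measurableSet_singleton true)

lemma measurableSet_le_returnTime (hC : MeasurableSet C) (t : ℕ) :
    MeasurableSet {ω : ℕ → X × Bool | (t : ℕ∞) ≤ returnTime C ω} := by
  rw [setOf_le_returnTime]
  simp only [Set.ofPred_forall]
  exact MeasurableSet.iInter fun j => MeasurableSet.iInter fun _ =>
    (measurableSet_atom hC).compl.preimage (measurable_pi_apply j)

lemma expectedReturnTime_eq_tsum (hC : MeasurableSet C) (Pr : Measure (ℕ → X × Bool)) :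
    expectedReturnTime Pr C = ∑' t : ℕ, Pr {ω | ((t + 1 : ℕ) : ℕ∞) ≤ returnTime C ω} := by
  classical
  rw [expectedReturnTime]
  simp_rw [← tsum_ite_succ_le (returnTime C _)]
  rw [lintegral_tsum fun t => (Measurable.ite (measurableSet_le_returnTime hC _)
    measurable_const measurable_const).aemeasurable]
  refine tsum_congr fun t => ?_
  rw [← lintegral_indicator_one (measurableSet_le_returnTime hC _)]
  simp [Set.indicator_apply]

lemma splitKernel_atom (h : OneStepMinorization P π C ε ν) {z : X × Bool} (hz : z ∈ atom C) :
    splitKernel h z = ν.prod (coin ε) := by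
  have := h.isProbabilityMeasure_coin
  rw [splitKernel, Kernel.prod_apply, Kernel.const_apply]
  congr 1
  change stepMeasure P C ε ν z = ν
  have hz2 : z.2 = true := hz.2
  rw [stepMeasure, if_pos hz.1, if_pos hz2]

/-- Averaging the split transition over the coin gives back the original transition. -/
lemma stepMeasure_average (h : OneStepMinorization P π C ε ν) (x : X) {A : Set X}
    (hA : MeasurableSet A) :
    ε * stepMeasure P C ε ν (x, true) A + ((1 - ε : ℝ≥0) : ℝ≥0∞) * stepMeasure P C ε ν (x, false) A
      = P x A := by
  by_cases hx : x ∈ C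
  · have hmin : (ε : ℝ≥0∞) * ν A ≤ P x A := h.minorization x hx A
    by_cases h1 : ε = 1
    · -- here `P x` and `ν` are probability measures with `ν ≤ P x`
      subst h1
      have : ν = P x := Measure.eq_of_le_of_isProbabilityMeasure (by simpa using h.minorization x hx)
      simp [stepMeasure, hx, this]
    · have hne : (1 - ε : ℝ≥0) ≠ 0 := (tsub_pos_of_lt (lt_of_le_of_ne h.eps_le_one h1)).ne'
      simp only [stepMeasure, hx, residual, h1, if_true, if_false, Bool.false_eq_true]
      rw [Measure.smul_apply, Measure.sub_apply hA (h.minorization x hx), Measure.smul_apply,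
        ENNReal.smul_def, ENNReal.smul_def, smul_eq_mul, smul_eq_mul, ← mul_assoc,
        ← ENNReal.coe_mul, mul_inv_cancel₀ hne, ENNReal.coe_one, one_mul,
        add_tsub_cancel_of_le hmin]
  · simp only [stepMeasure, hx, if_false]
    rw [← add_mul, ← ENNReal.coe_add, add_tsub_cancel_of_le h.eps_le_one, ENNReal.coe_one, one_mul]

lemma prod_coin_bind_stepKernel (h : OneStepMinorization P π C ε ν) (r : Measure X) [SFinite r] :
    (r.prod (coin ε)).bind (stepKernel h) = r.bind P := by
  have := h.isProbabilityMeasure_coin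
  ext A hA
  rw [Measure.bind_apply hA (Kernel.aemeasurable _), Measure.bind_apply hA (Kernel.aemeasurable _),
    lintegral_prod _ (Kernel.measurable_coe _ hA).aemeasurable]
  refine lintegral_congr fun x => ?_
  rw [← stepMeasure_average h x hA, coin, lintegral_add_measure, lintegral_smul_measure,
    lintegral_smul_measure, lintegral_dirac, lintegral_dirac]
  rfl

/-- After one step the second coordinate of the split chain is a coin independent of the first. -/
lemma bind_splitKernel (h : OneStepMinorization P π C ε ν) (ρ : Measure (X × Bool))
    [IsFiniteMeasure ρ] :
    ρ.bind (splitKernel h) = (ρ.bind (stepKernel h)).prod (coin ε) := by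
  have := h.isProbabilityMeasure_coin
  refine (Measure.prod_eq fun A D hA hD => ?_).symm
  rw [Measure.bind_apply (hA.prod hD) (Kernel.aemeasurable _),
    Measure.bind_apply hA (Kernel.aemeasurable _),
    ← lintegral_mul_const _ (Kernel.measurable_coe _ hA)]
  refine lintegral_congr fun z => ?_
  rw [splitKernel, Kernel.prod_apply, Measure.prod_prod, Kernel.const_apply]

/-- The split chain inherits the invariant measure: `π ⊗ Ber(ε)`. -/
lemma invariant_prod_coin (h : OneStepMinorization P π C ε ν) [IsFiniteMeasure π]
    (hinv : P.Invariant π) :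
    (splitKernel h).Invariant (π.prod (coin ε)) := by
  have := h.isProbabilityMeasure_coin
  rw [Kernel.Invariant, bind_splitKernel, prod_coin_bind_stepKernel, hinv.def]

lemma prod_coin_atom (r : Measure X) : r.prod (coin ε) (atom C) = r C * ε := by
  have : IsFiniteMeasure (coin ε) := by unfold coin; infer_instance
  rw [atom, Measure.prod_prod]
  rw [coin, Measure.add_apply, Measure.smul_apply, Measure.smul_apply]
  simp [ENNReal.smul_def]

end Split

/-! ### Uniqueness of the invariant measure -/

lemma invariant_pow {X : Type*} [MeasurableSpace X] {P : Kernel X X} {r : Measure X}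
    (hr : P.Invariant r) (n : ℕ) : (P ^ n).Invariant r := by
  induction n with
  | zero =>
    rw [pow_zero]
    exact Measure.bind_dirac
  | succ n ih =>
    rw [pow_succ]
    exact ih.comp hr

/-- For an irreducible chain, an invariant measure that vanishes on a set of positive
irreducibility measure is zero. -/
lemma eq_zero_of_invariant {X : Type*} [MeasurableSpace X] {P : Kernel X X}
    {π r : Measure X} {C : Set X} (hirr : Kernel.IsIrreducible π P) (hC : MeasurableSet C)
    (hπC : 0 < π C) (hr : P.Invariant r) (hrC : r C = 0) : r = 0 := by
  -- `r C = ∫ P ^ n x C dr` for all `n`, while irreducibility makes some `P ^ n x C` positive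
  have hn : ∀ n : ℕ, ∀ᵐ x ∂r, (P ^ n) x C = 0 := by
    intro n
    rw [← (invariant_pow hr n).def, Measure.bind_apply hC (Kernel.aemeasurable _),
      lintegral_eq_zero_iff (Kernel.measurable_coe _ hC)] at hrC
    exact hrC
  rw [← ae_eq_bot, ← Filter.eventually_false_iff_eq_bot]
  filter_upwards [ae_all_iff.2 hn] with x hx
  obtain ⟨n, hpos⟩ := hirr.irreducible hC hπC x
  exact hpos.ne' (hx n)

/-- The second coordinate of the split chain is an independent coin, so an invariant measure is a
product `r ⊗ Ber(ε)` with `r` invariant for `P`, and vanishes on the atom only if `r C = 0`. -/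
lemma eq_zero_of_invariant_splitKernel {X : Type*} [MeasurableSpace X] {P : Kernel X X}
    [IsMarkovKernel P] {π : Measure X} {C : Set X} {ε : ℝ≥0} {ν : Measure X}
    [IsProbabilityMeasure ν] (h : OneStepMinorization P π C ε ν)
    (hirr : Kernel.IsIrreducible π P) {ρ : Measure (X × Bool)} [IsFiniteMeasure ρ]
    (hρ : (splitKernel h).Invariant ρ) (hρα : ρ (atom C) = 0) : ρ = 0 := by
  have hprod : ρ = (ρ.bind (stepKernel h)).prod (coin ε) := by
    rw [← bind_splitKernel, hρ.def]
  have hr : P.Invariant (ρ.bind (stepKernel h)) := by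
    rw [Kernel.Invariant, ← prod_coin_bind_stepKernel h, ← hprod]
  have hrC : ρ.bind (stepKernel h) C = 0 := by
    rw [hprod, prod_coin_atom] at hρα
    exact (mul_eq_zero.1 hρα).resolve_right (by exact_mod_cast h.eps_pos.ne')
  rw [hprod, eq_zero_of_invariant hirr h.measurableSet h.measure_pos hr hrC, Measure.zero_prod]

end SplitChain

/-! ### The mixture representation of the invariant measure -/

open SplitChain in
/-- Here `μ₀` is any initial law of the split chain concentrated on the atom `α = C × {1}`, so that
`SplitChain.chainLaw (SplitChain.splitKernel hmin) μ₀` is `Pr_α`. -/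
theorem theorem1 {X : Type*} [MeasurableSpace X]
    (P : Kernel X X) [IsMarkovKernel P]
    (π : Measure X) [IsProbabilityMeasure π]
    (hirr : Kernel.IsIrreducible π P)
    (hinv : Kernel.Invariant P π)
    (hHarris : SplitChain.IsHarrisRecurrent P)
    (C : Set X) (ε : ℝ≥0) (ν : Measure X) [IsProbabilityMeasure ν]
    (hmin : SplitChain.OneStepMinorization P π C ε ν)
    (μ₀ : Measure (X × Bool)) [IsProbabilityMeasure μ₀]
    (hμ₀ : μ₀ (SplitChain.atom C)ᶜ = 0)
    (Pr : Measure (ℕ → X × Bool))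
    (hPr : Pr = SplitChain.chainLaw (SplitChain.splitKernel hmin) μ₀) :
    SplitChain.expectedReturnTime Pr C < ∞ ∧
    ∑' t : ℕ, SplitChain.mixWeight Pr C (t + 1) = 1 ∧
    (∀ t : ℕ, 1 ≤ t → SplitChain.mixWeight Pr C t ≠ 0 →
      IsProbabilityMeasure (SplitChain.mixComponent Pr C t)) ∧
    ∀ A : Set X, MeasurableSet A →
      π A = ∑' t : ℕ, SplitChain.mixComponent Pr C (t + 1) A * SplitChain.mixWeight Pr C (t + 1) := by
  have := hmin.isProbabilityMeasure_coin
  have hC := hmin.measurableSet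
  have hα := measurableSet_atom hC
  have hprob : IsProbabilityMeasure Pr := by rw [hPr]; infer_instance
  have hκ : ∀ z ∈ atom C, splitKernel hmin z = ν.prod (coin ε) :=
    fun z hz => splitKernel_atom hmin hz
  have hπinv := invariant_prod_coin hmin hinv
  have hpos : π.prod (coin ε) (atom C) ≠ 0 := by
    rw [prod_coin_atom]
    exact mul_ne_zero hmin.measure_pos.ne' (by exact_mod_cast hmin.eps_pos.ne')
  have hkac := eq_smul_occupation hα hκ hπinv hpos
    fun ρ _ hρ hρα => eq_zero_of_invariant_splitKernel hmin hirr hρ hρα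
  have hfin := occupation_univ_lt_top hα hκ hπinv hpos
  have hlaw : ∀ t : ℕ, ∀ B, MeasurableSet B →
      Pr ({ω | ((t + 1 : ℕ) : ℕ∞) ≤ returnTime C ω} ∩ (fun ω => ω (t + 1)) ⁻¹' B)
        = excursionLaw (splitKernel hmin) (atom C) (ν.prod (coin ε)) t B := by
    intro t B hB
    rw [← map_restrict_chainLaw hα hκ hμ₀ t, ← hPr, Measure.map_apply (by fun_prop) hB,
      Measure.restrict_apply (hB.preimage (measurable_pi_apply (t + 1))), setOf_le_returnTime,
      Set.inter_comm]
  have hE : expectedReturnTime Pr C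
      = occupation (splitKernel hmin) (atom C) (ν.prod (coin ε)) Set.univ := by
    rw [expectedReturnTime_eq_tsum hC, occupation, Measure.sum_apply _ MeasurableSet.univ]
    refine tsum_congr fun t => ?_
    simpa using hlaw t Set.univ MeasurableSet.univ
  -- Kac's formula in total mass: `1 = π'(α) E_α(τ_α)` for `π' = π ⊗ Ber(ε)`
  have hmass : π.prod (coin ε) (atom C) * expectedReturnTime Pr C = 1 := by
    have h1 := congrArg (fun m => m Set.univ) hkac
    rw [hE]
    simpa using h1.symm
  have hE0 : expectedReturnTime Pr C ≠ 0 := right_ne_zero_of_mul (hmass ▸ one_ne_zero)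
  have hEtop : expectedReturnTime Pr C ≠ ∞ := hE ▸ hfin.ne
  refine ⟨hEtop.lt_top, ?_, ?_, ?_⟩
  · simp_rw [mixWeight, div_eq_mul_inv]
    rw [ENNReal.tsum_mul_right, ← expectedReturnTime_eq_tsum hC, ENNReal.mul_inv_cancel hE0 hEtop]
  · intro t _ ht
    have hne : Pr {ω | (t : ℕ∞) ≤ returnTime C ω} ≠ 0 := by
      intro h0
      exact ht (by rw [mixWeight, h0, ENNReal.zero_div])
    have := cond_isProbabilityMeasure hne
    exact Measure.isProbabilityMeasure_map (measurable_pi_apply t).fst.aemeasurable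
  · intro A hA
    have hterm : ∀ t : ℕ, mixComponent Pr C (t + 1) A * mixWeight Pr C (t + 1)
        = excursionLaw (splitKernel hmin) (atom C) (ν.prod (coin ε)) t (A ×ˢ Set.univ)
          * (expectedReturnTime Pr C)⁻¹ := by
      intro t
      rw [← hlaw t _ (hA.prod MeasurableSet.univ), mixComponent, mixWeight,
        Measure.map_apply (by fun_prop) hA, div_eq_mul_inv, ← mul_assoc,
        cond_mul_eq_inter (measurableSet_le_returnTime hC _)]
      congr 3
      ext ω
      simp
    simp_rw [hterm]
    rw [ENNReal.tsum_mul_right, ← Measure.sum_apply _ (hA.prod MeasurableSet.univ),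
      ← ENNReal.eq_inv_of_mul_eq_one_left hmass, mul_comm]
    have h1 := congrArg (fun m => m (A ×ˢ (Set.univ : Set Bool))) hkac
    rwa [Measure.smul_apply, smul_eq_mul, Measure.prod_prod, measure_univ, mul_one] at h1
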